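/- Let $k$ be an algebraically closed field of characteristic zero and let $R=k[x_0,x_1,y_0,y_1]$ be the coordinate ring of $\mathbb{P}^1\times\mathbb{P}^1$ over $k$, bigraded by $\deg x_i=(1,0)$ and $\deg y_j=(0,1)$. Let $X\subseteq\mathbb{P}^1\times\mathbb{P}^1$ be a nonempty finite set of points, and let $I_X\subseteq R$ be the ideal generated by all bihomogeneous forms that vanish at every point of $X$. The set $X$ is called arithmetically Cohen–Macaulay (ACM) if $\operatorname{depth} R/I_X=2$, where the depth is the supremum of the lengths of the $R/I_X$-regular sequences contained in $(x_0,x_1,y_0,y_1)$. For $P\in X$, a separator for $P$ is a bihomogeneous form $F\in R$ with $F(P)\neq 0$ and $F(Q)=0$ for all $Q\in X\setminus\{P\}$, and $\deg_X(P)\subseteq\mathbb{N}^2$ is the set of the minimal elements, with respect to the componentwise partial order on $\mathbb{N}^2$, of the set of bidegrees of the separators for $P$. Theorem. $X$ is ACM if and only if $|\deg_X(P)|=1$ for every $P\in X$. -/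

import Mathlib

open scoped LinearAlgebra.Projectivization

namespace BiProj

/-- The set of closed points of `ℙ¹ × ℙ¹` over `k`. -/
abbrev Point (k : Type*) [Field k] : Type _ := ℙ k (Fin 2 → k) × ℙ k (Fin 2 → k)

/-- The coordinate ring `k[x₀, x₁, y₀, y₁]` of `ℙ¹ × ℙ¹`; `Sum.inl i` is the index of `xᵢ` and
`Sum.inr j` is the index of `yⱼ`. -/
abbrev CoordRing (k : Type*) [Field k] : Type _ := MvPolynomial (Fin 2 ⊕ Fin 2) k

/-- The bigrading: `deg xᵢ = (1, 0)` and `deg yⱼ = (0, 1)`. -/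
def bidegree : Fin 2 ⊕ Fin 2 → ℕ × ℕ := Sum.elim (fun _ => (1, 0)) (fun _ => (0, 1))

/-- `F` is a bihomogeneous form of bidegree `d`. -/
def IsForm {k : Type*} [Field k] (F : CoordRing k) (d : ℕ × ℕ) : Prop :=
  MvPolynomial.IsWeightedHomogeneous bidegree F d

/-- `F(P) = 0`, computed on homogeneous coordinates of `P`. For a bihomogeneous form `F` this does
not depend on the choice of the coordinates, see `vanishesAt_mk_iff`. -/
def VanishesAt {k : Type*} [Field k] (F : CoordRing k) (P : Point k) : Prop :=
  MvPolynomial.eval (Sum.elim P.1.rep P.2.rep) F = 0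

/-- Rescaling the two blocks of coordinates multiplies the value of a form by a monomial in the
scaling factors. -/
theorem IsForm.eval_smul {k : Type*} [Field k] {F : CoordRing k} {d : ℕ × ℕ} (hF : IsForm F d)
    (a b : k) (v w : Fin 2 → k) :
    MvPolynomial.eval (Sum.elim (a • v) (b • w)) F
      = a ^ d.1 * b ^ d.2 * MvPolynomial.eval (Sum.elim v w) F := by
  rw [MvPolynomial.eval_eq', MvPolynomial.eval_eq', Finset.mul_sum]
  refine Finset.sum_congr rfl fun e he => ?_
  have h := hF (MvPolynomial.mem_support_iff.mp he)
  rw [Finsupp.weight_apply, Finsupp.sum_fintype _ _ (by simp)] at h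
  simp only [Fintype.sum_sum_type, Fin.sum_univ_two, bidegree, Sum.elim_inl, Sum.elim_inr] at h
  subst h
  simp only [Fintype.prod_sum_type, Fin.prod_univ_two, Sum.elim_inl, Sum.elim_inr, Pi.smul_apply,
    smul_eq_mul, mul_pow, Prod.fst_add, Prod.snd_add, Prod.smul_mk, mul_one, mul_zero, pow_add,
    add_zero, zero_add]
  ring

theorem vanishesAt_mk_iff {k : Type*} [Field k] {F : CoordRing k} {d : ℕ × ℕ} (hF : IsForm F d)
    (v w : Fin 2 → k) (hv : v ≠ 0) (hw : w ≠ 0) :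
    VanishesAt F (Projectivization.mk k v hv, Projectivization.mk k w hw) ↔
      MvPolynomial.eval (Sum.elim v w) F = 0 := by
  obtain ⟨a, ha⟩ := Projectivization.exists_smul_eq_mk_rep k v hv
  obtain ⟨b, hb⟩ := Projectivization.exists_smul_eq_mk_rep k w hw
  have h := hF.eval_smul (a : k) (b : k) v w
  unfold VanishesAt
  simp only [← ha, ← hb]
  simp only [Units.smul_def, h]
  simp

/-- The bihomogeneous ideal `I_X`, generated by all the forms that vanish at every point of `X`. -/
noncomputable def idealOfPoints {k : Type*} [Field k] (X : Set (Point k)) : Ideal (CoordRing k) :=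
  Ideal.span {F | (∃ d, IsForm F d) ∧ ∀ P ∈ X, VanishesAt F P}

/-- The irrelevant maximal ideal `(x₀, x₁, y₀, y₁)`. -/
noncomputable def irrelevantIdeal (k : Type*) [Field k] : Ideal (CoordRing k) :=
  Ideal.span (Set.range MvPolynomial.X)

/-- The depth of the `R`-module `M` with respect to the ideal `I`: the supremum of the lengths of
the `M`-regular sequences contained in `I`. -/
noncomputable def depth {R : Type*} [CommRing R] (I : Ideal R) (M : Type*) [AddCommGroup M]
    [Module R M] : ℕ∞ :=
  ⨆ rs : {rs : List R // (∀ r ∈ rs, r ∈ I) ∧ RingTheory.Sequence.IsRegular M rs},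
    (rs.1.length : ℕ∞)

/-- `X` is arithmetically Cohen–Macaulay: `depth R/I_X = 2`. -/
def IsACM {k : Type*} [Field k] (X : Set (Point k)) : Prop :=
  depth (irrelevantIdeal k) (CoordRing k ⧸ idealOfPoints X) = 2

/-- `F`, a form of bidegree `d`, is a separator for the point `P` of `X`. -/
def IsSeparator {k : Type*} [Field k] (X : Set (Point k)) (P : Point k) (F : CoordRing k)
    (d : ℕ × ℕ) : Prop :=
  IsForm F d ∧ ¬ VanishesAt F P ∧ ∀ Q ∈ X \ {P}, VanishesAt F Q

/-- The degree `deg_X(P)`: the set of the minimal bidegrees of separators for `P ∈ X`, with respect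
to the componentwise partial order of `ℕ × ℕ`. -/
def pointDegree {k : Type*} [Field k] (X : Set (Point k)) (P : Point k) : Set (ℕ × ℕ) :=
  {d | Minimal (fun e => ∃ F, IsSeparator X P F e) d}

end BiProj

/-! Both conditions say that the rows of `X` are nested (`HasNestedRows`). The basic tool is zero
counting: a form with more zeros on a line of a ruling than its degree along that line vanishes on
the whole line.

Degrees of points. If the rows are nested, the lines through the other points of the row and the
column of `P` cover `X \ {P}`, and their product has the least possible bidegree. Conversely,
products of lines give one separator of least degree in `x` and another of least degree in `y`. A
unique minimal bidegree is below both, and zero counting then makes the rows comparable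
(`hasNestedRows_of_encard_pointDegree`).

ACM. Let `l` be the linear form in `y` of a point `B₀` that is no second coordinate of `X`; it is
regular modulo `I_X`. For nested rows, a form of bidegree `d` lies in `I_X + (l)` iff it vanishes at
`(A, B₀)` for every row `A` with more than `d.2` points. Multiplication by `linX` of an unused point
`A₀` does not affect this condition, so `l, linX A₀` is regular, while `dim R/I_X ≤ 2` bounds the
depth above. Conversely, depth two leaves no nonzero element of `R/(I_X, l)` killed by a power of
the irrelevant ideal (`mem_of_le_radical_colon`). This forces a product of linear forms into `I_X +
(l)`, and zero counting on an element of `I_X` congruent to it excludes rows that are not nested. -/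

namespace BiProj

open MvPolynomial

/-! ### Linear forms, substitutions and divisibility. -/

section Forms

variable {k : Type*} [Field k]

/-- The linear form in `x₀, x₁` whose zero is the point with homogeneous coordinates `v`. -/
noncomputable def linX (v : Fin 2 → k) : CoordRing k :=
  C (v 1) * X (Sum.inl 0) - C (v 0) * X (Sum.inl 1)

/-- The linear form in `y₀, y₁` whose zero is the point with homogeneous coordinates `w`. -/
noncomputable def linY (w : Fin 2 → k) : CoordRing k :=
  C (w 1) * X (Sum.inr 0) - C (w 0) * X (Sum.inr 1)

/-- The exchange of the two blocks of variables. -/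
noncomputable def swapVars : CoordRing k ≃ₐ[k] CoordRing k :=
  renameEquiv k (Equiv.sumComm (Fin 2) (Fin 2))

/-- Substitution of `w` for `y`. -/
noncomputable def substY (w : Fin 2 → k) : CoordRing k →ₐ[k] CoordRing k :=
  aeval (Sum.elim (fun i => X (Sum.inl i)) (fun j => C (w j)))

/-- The values lie in an algebra so that a scaling factor can itself be a linear form. -/
theorem IsForm.aeval_mul {S : Type*} [CommRing S] [Algebra k S] {F : CoordRing k} {d : ℕ × ℕ}
    (hF : IsForm F d) (a b : S) (v w : Fin 2 → S) :
    aeval (Sum.elim (fun i => a * v i) (fun j => b * w j)) F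
      = a ^ d.1 * b ^ d.2 * aeval (Sum.elim v w) F := by
  rw [aeval_def, aeval_def, eval₂_eq', eval₂_eq', Finset.mul_sum]
  refine Finset.sum_congr rfl fun e he => ?_
  have h := hF (MvPolynomial.mem_support_iff.mp he)
  rw [Finsupp.weight_apply, Finsupp.sum_fintype _ _ (by simp)] at h
  simp only [Fintype.sum_sum_type, Fin.sum_univ_two, bidegree, Sum.elim_inl, Sum.elim_inr] at h
  subst h
  simp only [Fintype.prod_sum_type, Fin.prod_univ_two, Sum.elim_inl, Sum.elim_inr,
    mul_pow, Prod.fst_add, Prod.snd_add, Prod.smul_mk, mul_one, mul_zero, pow_add,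
    add_zero, zero_add, smul_eq_mul]
  ring

theorem IsForm.aeval {F : CoordRing k} {d : ℕ × ℕ} (hF : IsForm F d) (φ : ℕ × ℕ →+ ℕ × ℕ)
    (f : Fin 2 ⊕ Fin 2 → CoordRing k) (hf : ∀ z, IsForm (f z) (φ (bidegree z))) :
    IsForm (MvPolynomial.aeval f F) (φ d) := by
  unfold IsForm
  rw [aeval_def, eval₂_eq']
  refine IsWeightedHomogeneous.sum _ _ _ fun e he => ?_
  have h := hF (MvPolynomial.mem_support_iff.mp he)
  rw [Finsupp.weight_apply, Finsupp.sum_fintype _ _ (by simp)] at h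
  rw [← h, map_sum]
  simp only [map_nsmul]
  refine IsWeightedHomogeneous.C_mul ?_ _
  exact IsWeightedHomogeneous.prod _ _ _ fun z _ => (hf z).pow _

theorem IsForm.swapVars {F : CoordRing k} {d : ℕ × ℕ} (hF : IsForm F d) :
    IsForm (swapVars F) d.swap := by
  have e : (BiProj.swapVars (k := k)).toAlgHom =
      MvPolynomial.aeval (fun z => X (Equiv.sumComm (Fin 2) (Fin 2) z)) := by
    ext z
    simp [BiProj.swapVars]
  have e' : BiProj.swapVars F = _ := DFunLike.congr_fun e F
  rw [e']
  exact hF.aeval (AddMonoidHom.prod (AddMonoidHom.snd ℕ ℕ) (AddMonoidHom.fst ℕ ℕ))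
    (fun z => X (Equiv.sumComm (Fin 2) (Fin 2) z)) (fun z => by
      rcases z with z | z
      · exact isWeightedHomogeneous_X k bidegree (Sum.inr z)
      · exact isWeightedHomogeneous_X k bidegree (Sum.inl z))

theorem IsForm.substY {F : CoordRing k} {d : ℕ × ℕ} (hF : IsForm F d) (w : Fin 2 → k) :
    IsForm (substY w F) (d.1, 0) :=
  hF.aeval (AddMonoidHom.prod (AddMonoidHom.fst ℕ ℕ) 0)
    (Sum.elim (fun i => X (Sum.inl i)) (fun j => C (w j))) (fun z => by
      rcases z with z | z
      · exact isWeightedHomogeneous_X k bidegree (Sum.inl z)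
      · exact isWeightedHomogeneous_C bidegree (w z))

theorem isForm_linX (v : Fin 2 → k) : IsForm (linX v) (1, 0) :=
  ((isWeightedHomogeneous_X k bidegree (Sum.inl 0)).C_mul _).sub
    ((isWeightedHomogeneous_X k bidegree (Sum.inl 1)).C_mul _)

theorem isForm_linY (w : Fin 2 → k) : IsForm (linY w) (0, 1) :=
  ((isWeightedHomogeneous_X k bidegree (Sum.inr 0)).C_mul _).sub
    ((isWeightedHomogeneous_X k bidegree (Sum.inr 1)).C_mul _)

@[simp]
theorem swapVars_linX (v : Fin 2 → k) : swapVars (linX v) = linY v := by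
  simp [swapVars, linX, linY]

theorem eval_swapVars (v w : Fin 2 → k) (F : CoordRing k) :
    eval (Sum.elim v w) (swapVars F) = eval (Sum.elim w v) F := by
  simp only [swapVars, renameEquiv_apply, eval_rename]
  congr 2
  ext z
  rcases z with z | z <;> rfl

theorem eval_substY (v w w' : Fin 2 → k) (F : CoordRing k) :
    eval (Sum.elim v w') (substY w F) = eval (Sum.elim v w) F := by
  have : ((MvPolynomial.aeval (Sum.elim v w')).comp (substY w) : CoordRing k →ₐ[k] k)
      = MvPolynomial.aeval (Sum.elim v w) := by
    ext z
    rcases z with z | z <;> simp [BiProj.substY]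
  exact DFunLike.congr_fun this F

@[simp]
theorem substY_linX (v w : Fin 2 → k) : substY w (linX v) = linX v := by
  simp [substY, linX]

@[simp]
theorem eval_linX (v v' w : Fin 2 → k) :
    eval (Sum.elim v' w) (linX v) = v 1 * v' 0 - v 0 * v' 1 := by
  simp [linX]

@[simp]
theorem eval_linY (v w w' : Fin 2 → k) :
    eval (Sum.elim v w') (linY w) = w 1 * w' 0 - w 0 * w' 1 := by
  simp [linY]

/-- The linear forms `linX m` and `linY m` take the value `1` at `v`. -/
theorem exists_dual {v : Fin 2 → k} (hv : v ≠ 0) : ∃ m : Fin 2 → k, m 1 * v 0 - m 0 * v 1 = 1 := by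
  by_cases h : v 0 = 0
  · have h1 : v 1 ≠ 0 := fun h1 => hv (by ext i; fin_cases i <;> assumption)
    exact ⟨![-(v 1)⁻¹, 0], by simp [h1]⟩
  · exact ⟨![0, (v 0)⁻¹], by simp [h]⟩

theorem det_rep_eq_zero_iff (A B : ℙ k (Fin 2 → k)) :
    A.rep 1 * B.rep 0 - A.rep 0 * B.rep 1 = 0 ↔ A = B := by
  refine ⟨fun h => ?_, fun h => by rw [h]; ring⟩
  rw [← A.mk_rep, ← B.mk_rep, Projectivization.mk_eq_mk_iff']
  obtain ⟨m, hm⟩ := exists_dual B.rep_nonzero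
  refine ⟨m 1 * A.rep 0 - m 0 * A.rep 1, ?_⟩
  ext i
  fin_cases i
  · simp only [Fin.zero_eta, Pi.smul_apply, smul_eq_mul]
    linear_combination A.rep 0 * hm - m 0 * h
  · simp only [Fin.mk_one, Pi.smul_apply, smul_eq_mul]
    linear_combination A.rep 1 * hm - m 1 * h

/-- Substituting a point of the line for `x`, scaled by a linear form `m` that is `1` there, is
the projection modulo the linear form of that point. -/
theorem sub_aeval_mem_span_linX {v m : Fin 2 → k} (hm : m 1 * v 0 - m 0 * v 1 = 1)
    (F : CoordRing k) :
    F - MvPolynomial.aeval (Sum.elim (fun i => linX m * C (v i)) (fun j => X (Sum.inr j))) F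
      ∈ Ideal.span {linX v} := by
  rw [← Ideal.Quotient.eq]
  have : (Ideal.Quotient.mkₐ k (Ideal.span {linX v})) =
      (Ideal.Quotient.mkₐ k (Ideal.span {linX v})).comp
        (MvPolynomial.aeval (Sum.elim (fun i => linX m * C (v i)) (fun j => X (Sum.inr j)))) := by
    have hm' : C (m 1) * C (v 0) - C (m 0) * C (v 1) = (1 : CoordRing k) := by
      rw [← C_mul, ← C_mul, ← C_sub, hm, C_1]
    ext z
    rcases z with z | z
    · simp only [AlgHom.comp_apply, aeval_X, Sum.elim_inl, Ideal.Quotient.mkₐ_eq_mk]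
      rw [Ideal.Quotient.eq, Ideal.mem_span_singleton']
      -- Each difference `xᵢ - linX m * vᵢ` equals `-mᵢ * linX v`.
      fin_cases z
      · refine ⟨-C (m 0), ?_⟩
        simp only [linX, Fin.zero_eta]
        linear_combination X (Sum.inl 0) * hm'
      · refine ⟨-C (m 1), ?_⟩
        simp only [linX, Fin.mk_one]
        linear_combination X (Sum.inl 1) * hm'
    · simp
  exact DFunLike.congr_fun this F

theorem linX_dvd_iff {v m : Fin 2 → k} (hm : m 1 * v 0 - m 0 * v 1 = 1) (F : CoordRing k) :
    linX v ∣ F ↔ MvPolynomial.aeval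
      (Sum.elim (fun i => linX m * C (v i)) (fun j => X (Sum.inr j))) F = 0 := by
  refine ⟨?_, fun h => ?_⟩
  · rintro ⟨G, rfl⟩
    rw [map_mul]
    convert zero_mul _
    simp [linX]
    ring
  · have := sub_aeval_mem_span_linX hm F
    rwa [h, sub_zero, Ideal.mem_span_singleton] at this

/-- By `linX_dvd_iff`, the form generates the kernel of a homomorphism into a domain. -/
theorem prime_linX {v : Fin 2 → k} (hv : v ≠ 0) : Prime (linX v) := by
  obtain ⟨m, hm⟩ := exists_dual hv
  refine ⟨fun h => ?_, fun h => ?_, fun a b h => ?_⟩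
  · have h1 : eval (Sum.elim m 0) (linX v) = 0 := by rw [h, map_zero]
    rw [eval_linX] at h1
    exact one_ne_zero (by linear_combination -hm - h1 : (1 : k) = 0)
  · have := (linX_dvd_iff hm 1).1 (isUnit_iff_dvd_one.1 h)
    simp at this
  · simpa [linX_dvd_iff hm] using h

theorem IsForm.sub_mem_span_linX {F : CoordRing k} {d : ℕ × ℕ} (hF : IsForm F d)
    {v m : Fin 2 → k} (hm : m 1 * v 0 - m 0 * v 1 = 1) :
    F - linX m ^ d.1 *
      MvPolynomial.aeval (Sum.elim (fun i => C (v i)) (fun j => X (Sum.inr j))) F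
      ∈ Ideal.span {linX v} := by
  have := sub_aeval_mem_span_linX hm F
  have h := hF.aeval_mul (linX m) 1 (fun i => C (v i)) (fun j => X (Sum.inr j))
  simp only [one_mul, one_pow, mul_one] at h
  rwa [h] at this

theorem IsForm.sub_mem_span_linY {F : CoordRing k} {d : ℕ × ℕ} (hF : IsForm F d)
    {w m : Fin 2 → k} (hm : m 1 * w 0 - m 0 * w 1 = 1) :
    F - linY m ^ d.2 * BiProj.substY w F ∈ Ideal.span {linY w} := by
  have h := hF.swapVars.sub_mem_span_linX hm
  rw [Ideal.mem_span_singleton] at h ⊢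
  have h' := map_dvd (BiProj.swapVars (k := k)) h
  simp only [map_sub, map_mul, map_pow, swapVars_linX, Prod.fst_swap] at h'
  have e1 : (BiProj.swapVars (k := k)) (BiProj.swapVars F) = F := by
    simp [BiProj.swapVars, rename_rename]
  have e2 : ((BiProj.swapVars (k := k)).toAlgHom.comp ((MvPolynomial.aeval
      (Sum.elim (fun i => C (w i)) (fun j => X (Sum.inr j)))).comp
        (BiProj.swapVars (k := k)).toAlgHom)) = BiProj.substY w := by
    ext z
    rcases z with z | z <;> simp [BiProj.swapVars, BiProj.substY]
  rw [e1] at h'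
  convert h' using 3
  exact (DFunLike.congr_fun e2 F).symm

/-- Put `y = w` in the congruence `F ≡ (linX m) ^ d.1 * F(v, y)` modulo `linX v`. -/
theorem IsForm.linX_dvd_substY {F : CoordRing k} {d : ℕ × ℕ} (hF : IsForm F d)
    {v w : Fin 2 → k} (hv : v ≠ 0) (h : eval (Sum.elim v w) F = 0) :
    linX v ∣ BiProj.substY w F := by
  obtain ⟨m, hm⟩ := exists_dual hv
  have h1 := hF.sub_mem_span_linX hm
  rw [Ideal.mem_span_singleton] at h1
  have h2 := map_dvd (BiProj.substY w) h1
  have e : (BiProj.substY w).comp (MvPolynomial.aeval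
      (Sum.elim (fun i => C (v i)) (fun j => X (Sum.inr j)))) =
      (Algebra.ofId k (CoordRing k)).comp (MvPolynomial.aeval (Sum.elim v w)) := by
    ext z
    rcases z with z | z <;> simp [BiProj.substY, Algebra.ofId_apply]
  have e' := DFunLike.congr_fun e F
  have h' : MvPolynomial.aeval (Sum.elim v w) F = 0 := h
  simp only [AlgHom.comp_apply, h', map_zero] at e'
  rwa [map_sub, map_mul, e', mul_zero, sub_zero, substY_linX] at h2

end Forms

/-! ### Bigraded components and zero counting on lines. -/

section Grading

variable {k : Type*} [Field k]

/-- The component of bidegree `d`. -/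
noncomputable abbrev component (d : ℕ × ℕ) : CoordRing k →ₗ[k] CoordRing k :=
  weightedHomogeneousComponent bidegree d

attribute [local instance] MvPolynomial.weightedGradedAlgebra

theorem decompose_eq_component (F : CoordRing k) (d : ℕ × ℕ) :
    (DirectSum.decompose (weightedHomogeneousSubmodule k bidegree) F d : CoordRing k)
      = component d F :=
  weightedDecomposition.decompose'_apply k bidegree F d

theorem IsForm.component_mul {F : CoordRing k} {d : ℕ × ℕ} (hF : IsForm F d) (G : CoordRing k)
    (e : ℕ × ℕ) : component (d + e) (F * G) = F * component e G := by
  rw [← decompose_eq_component, ← decompose_eq_component]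
  exact DirectSum.coe_decompose_mul_add_of_left_mem _ hF

theorem IsForm.component_mul_of_not_le {F : CoordRing k} {d e : ℕ × ℕ} (hF : IsForm F d)
    (G : CoordRing k) (h : ¬ d ≤ e) : component e (F * G) = 0 := by
  rw [← decompose_eq_component]
  exact DirectSum.coe_decompose_mul_of_left_mem_of_not_le _ hF h

theorem isForm_component (d : ℕ × ℕ) (F : CoordRing k) : IsForm (component d F) d :=
  weightedHomogeneousComponent_isWeightedHomogeneous d F

theorem IsForm.component_eq {F : CoordRing k} {d : ℕ × ℕ} (hF : IsForm F d) :
    component d F = F :=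
  weightedHomogeneousComponent_eq_self hF

theorem component_mem_span {s : Set (CoordRing k)} (hs : ∀ F ∈ s, ∃ d, IsForm F d)
    {F : CoordRing k} (hF : F ∈ Ideal.span s) (d : ℕ × ℕ) : component d F ∈ Ideal.span s :=
  weightedHomogeneousComponent_mem_of_mem k bidegree
    (Ideal.homogeneous_span _ s fun F hF => hs F hF) hF d

theorem mem_of_component_mem {I : Ideal (CoordRing k)} {F : CoordRing k}
    (h : ∀ d, component d F ∈ I) : F ∈ I := by
  rw [← sum_weightedHomogeneousComponent bidegree F]
  exact finsum_induction (· ∈ I) I.zero_mem (fun _ _ => I.add_mem) h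

/-- To cancel a form modulo a homogeneous ideal, it is enough to cancel it in products with
forms. -/
theorem mem_span_of_mul_mem {s : Set (CoordRing k)} (hs : ∀ F ∈ s, ∃ d, IsForm F d)
    {L : CoordRing k} {e : ℕ × ℕ} (hL : IsForm L e)
    (h : ∀ F d, IsForm F d → L * F ∈ Ideal.span s → F ∈ Ideal.span s) {F : CoordRing k}
    (hF : L * F ∈ Ideal.span s) : F ∈ Ideal.span s :=
  mem_of_component_mem fun d => h _ d (isForm_component d F) <| by
    rw [← hL.component_mul]
    exact component_mem_span hs hF _

theorem isForm_prod_linX (Z : Finset (ℙ k (Fin 2 → k))) :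
    IsForm (∏ A ∈ Z, linX A.rep) (Z.card, 0) := by
  have := IsWeightedHomogeneous.prod (w := bidegree) Z (fun A => linX A.rep) _
    fun A _ => isForm_linX A.rep
  simpa [IsForm] using this

theorem isForm_prod_linY (Z : Finset (ℙ k (Fin 2 → k))) :
    IsForm (∏ B ∈ Z, linY B.rep) (0, Z.card) := by
  have := IsWeightedHomogeneous.prod (w := bidegree) Z (fun B => linY B.rep) _
    fun B _ => isForm_linY B.rep
  simpa [IsForm] using this

theorem eval_prod_linX_eq_zero_iff (Z : Finset (ℙ k (Fin 2 → k))) (A : ℙ k (Fin 2 → k))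
    (w : Fin 2 → k) :
    eval (Sum.elim A.rep w) (∏ A' ∈ Z, linX A'.rep) = 0 ↔ A ∈ Z := by
  simp [Finset.prod_eq_zero_iff, det_rep_eq_zero_iff]

theorem eval_prod_linY_eq_zero_iff (Z : Finset (ℙ k (Fin 2 → k))) (B : ℙ k (Fin 2 → k))
    (v : Fin 2 → k) :
    eval (Sum.elim v B.rep) (∏ B' ∈ Z, linY B'.rep) = 0 ↔ B ∈ Z := by
  simp [Finset.prod_eq_zero_iff, det_rep_eq_zero_iff]

theorem isRelPrime_linX {A B : ℙ k (Fin 2 → k)} (h : A ≠ B) :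
    IsRelPrime (linX A.rep) (linX B.rep) := by
  rw [(prime_linX A.rep_nonzero).irreducible.isRelPrime_iff_not_dvd]
  rintro ⟨G, hG⟩
  have := congrArg (eval (Sum.elim A.rep 0)) hG
  rw [map_mul, eval_linX, eval_linX] at this
  exact h ((det_rep_eq_zero_iff B A).1 (by linear_combination this)).symm

theorem isRelPrime_linX_linY (A B : ℙ k (Fin 2 → k)) :
    IsRelPrime (linX A.rep) (linY B.rep) := by
  rw [(prime_linX A.rep_nonzero).irreducible.isRelPrime_iff_not_dvd]
  rintro ⟨G, hG⟩
  obtain ⟨m, hm⟩ := exists_dual B.rep_nonzero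
  have := congrArg (eval (Sum.elim A.rep m)) hG
  rw [map_mul, eval_linX, eval_linY] at this
  exact one_ne_zero (by linear_combination - hm - this : (1 : k) = 0)

theorem IsForm.prod_linX_dvd_substY {F : CoordRing k} {d : ℕ × ℕ} (hF : IsForm F d)
    {w : Fin 2 → k} {Z : Finset (ℙ k (Fin 2 → k))}
    (h : ∀ A ∈ Z, eval (Sum.elim A.rep w) F = 0) :
    ∏ A ∈ Z, linX A.rep ∣ BiProj.substY w F :=
  Finset.prod_dvd_of_isRelPrime (fun _ _ _ _ hne => isRelPrime_linX hne)
    fun A hA => hF.linX_dvd_substY A.rep_nonzero (h A hA)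

/-- A form of degree `d.1` in `x` with more than `d.1` zeros on a horizontal line vanishes on
that line. -/
theorem IsForm.eval_eq_zero_of_card_left {F : CoordRing k} {d : ℕ × ℕ} (hF : IsForm F d)
    {w : Fin 2 → k} {Z : Finset (ℙ k (Fin 2 → k))} (hZ : d.1 < Z.card)
    (h : ∀ A ∈ Z, eval (Sum.elim A.rep w) F = 0) (v : Fin 2 → k) :
    eval (Sum.elim v w) F = 0 := by
  obtain ⟨G, hG⟩ := hF.prod_linX_dvd_substY h
  have h0 : BiProj.substY w F = 0 := by
    rw [← (hF.substY w).component_eq, hG]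
    -- The product has degree `Z.card > d.1` in `x`, so its only multiple of bidegree `(d.1, 0)` is
    -- `0`.
    exact (isForm_prod_linX Z).component_mul_of_not_le G fun hle => hZ.not_ge hle.1
  rw [← eval_substY v w w, h0, map_zero]

theorem IsForm.eval_eq_zero_of_card_right {F : CoordRing k} {d : ℕ × ℕ} (hF : IsForm F d)
    {v : Fin 2 → k} {Z : Finset (ℙ k (Fin 2 → k))} (hZ : d.2 < Z.card)
    (h : ∀ B ∈ Z, eval (Sum.elim v B.rep) F = 0) (w : Fin 2 → k) :
    eval (Sum.elim v w) F = 0 := by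
  rw [← eval_swapVars]
  exact hF.swapVars.eval_eq_zero_of_card_left hZ
    (fun B hB => by rw [eval_swapVars]; exact h B hB) w

end Grading

/-! ### Nested rows and unique minimal separator degrees. -/

section Separators

variable {k : Type*} [Field k]

open Classical in
/-- The second coordinates of the points of `X` whose first coordinate is `A`. -/
noncomputable def row (X : Finset (Point k)) (A : ℙ k (Fin 2 → k)) : Finset (ℙ k (Fin 2 → k)) :=
  (X.filter (·.1 = A)).image Prod.snd

open Classical in
/-- The first coordinates of the points of `X` whose second coordinate is `B`. -/
noncomputable def col (X : Finset (Point k)) (B : ℙ k (Fin 2 → k)) : Finset (ℙ k (Fin 2 → k)) :=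
  (X.filter (·.2 = B)).image Prod.fst

@[simp]
theorem mem_row {X : Finset (Point k)} {A B : ℙ k (Fin 2 → k)} : B ∈ row X A ↔ (A, B) ∈ X := by
  simp [row]

@[simp]
theorem mem_col {X : Finset (Point k)} {A B : ℙ k (Fin 2 → k)} : A ∈ col X B ↔ (A, B) ∈ X := by
  simp [col]

/-- The rows of `X` form a chain with respect to inclusion. -/
def HasNestedRows (X : Finset (Point k)) : Prop :=
  ∀ A A', (row X A).card ≤ (row X A').card → row X A ⊆ row X A'

theorem IsSeparator.of_vanishing {X : Finset (Point k)} {A B : ℙ k (Fin 2 → k)} {F : CoordRing k}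
    {d : ℕ × ℕ} (hF : IsForm F d) (h0 : eval (Sum.elim A.rep B.rep) F ≠ 0)
    (h : ∀ A' B', (A', B') ∈ X → (A', B') ≠ (A, B) → eval (Sum.elim A'.rep B'.rep) F = 0) :
    IsSeparator (X : Set (Point k)) (A, B) F d :=
  ⟨hF, h0, fun Q hQ => h Q.1 Q.2 hQ.1 hQ.2⟩

open Classical in
/-- A product of linear forms in `x` and linear forms in `y` separates `P` when its zeros cover the
other points of `X`. -/
theorem isSeparator_prod {X : Finset (Point k)} {A B : ℙ k (Fin 2 → k)}
    {Z W : Finset (ℙ k (Fin 2 → k))} (hA : A ∉ Z) (hB : B ∉ W)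
    (h : ∀ A' B', (A', B') ∈ X → (A', B') ≠ (A, B) → A' ∈ Z ∨ B' ∈ W) :
    IsSeparator (X : Set (Point k)) (A, B)
      ((∏ A' ∈ Z, linX A'.rep) * ∏ B' ∈ W, linY B'.rep) (Z.card, W.card) := by
  refine IsSeparator.of_vanishing ?_ ?_ fun A' B' h1 h2 => ?_
  · have := (isForm_prod_linX Z).mul (isForm_prod_linY W)
    simpa [IsForm] using this
  · rw [map_mul, mul_ne_zero_iff, Ne, Ne, eval_prod_linX_eq_zero_iff, eval_prod_linY_eq_zero_iff]
    exact ⟨hA, hB⟩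
  · rw [map_mul, mul_eq_zero, eval_prod_linX_eq_zero_iff, eval_prod_linY_eq_zero_iff]
    exact h A' B' h1 h2

/-- A separator of smaller degree in `x` would have too many zeros on the line `y = B`, and so
vanish at `(A, B)` too. -/
theorem pred_card_col_le {X : Finset (Point k)} {A B : ℙ k (Fin 2 → k)} {F : CoordRing k}
    {d : ℕ × ℕ} (hF : IsSeparator (X : Set (Point k)) (A, B) F d) : (col X B).card - 1 ≤ d.1 := by
  classical
  by_contra! h
  refine hF.2.1 (hF.1.eval_eq_zero_of_card_left
    (h.trans_le (Finset.pred_card_le_card_erase (a := A))) (fun A' hA' => ?_) _)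
  rw [Finset.mem_erase, mem_col] at hA'
  exact hF.2.2 (A', B) ⟨hA'.2, by simp [hA'.1]⟩

theorem pred_card_row_le {X : Finset (Point k)} {A B : ℙ k (Fin 2 → k)} {F : CoordRing k}
    {d : ℕ × ℕ} (hF : IsSeparator (X : Set (Point k)) (A, B) F d) : (row X A).card - 1 ≤ d.2 := by
  classical
  by_contra! h
  refine hF.2.1 (hF.1.eval_eq_zero_of_card_right
    (h.trans_le (Finset.pred_card_le_card_erase (a := B))) (fun B' hB' => ?_) _)
  rw [Finset.mem_erase, mem_row] at hB'
  exact hF.2.2 (A, B') ⟨hB'.2, by simp [hB'.1]⟩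

theorem HasNestedRows.encard_pointDegree {X : Finset (Point k)} (h : HasNestedRows X)
    {P : Point k} (hP : P ∈ X) : (pointDegree (X : Set (Point k)) P).encard = 1 := by
  classical
  obtain ⟨A, B⟩ := P
  rw [Set.encard_eq_one]
  refine ⟨((col X B).card - 1, (row X A).card - 1), ?_⟩
  have hsep : ∃ F, IsSeparator (X : Set (Point k)) (A, B) F
      ((col X B).card - 1, (row X A).card - 1) := by
    rw [← Finset.card_erase_of_mem (mem_col.2 hP), ← Finset.card_erase_of_mem (mem_row.2 hP)]
    refine ⟨_, isSeparator_prod (Finset.notMem_erase _ _) (Finset.notMem_erase _ _) ?_⟩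
    intro A' B' hQ hne
    simp only [Finset.mem_erase, mem_col, mem_row]
    -- An uncovered point `(A', B')` would make the rows of `A` and `A'` incomparable: `B` is only
    -- in the first, `B'` only in the second.
    by_contra! hcon
    by_cases hAA : A' = A
    · subst hAA
      exact hcon.2 (fun hB => hne (by rw [hB])) hQ
    · have hAB : B ∉ row X A' := fun hm => hcon.1 hAA (mem_row.1 hm)
      rcases le_total (row X A).card (row X A').card with hle | hle
      · exact hAB (h _ _ hle (mem_row.2 hP))
      · refine hcon.2 ?_ (mem_row.1 (h _ _ hle (mem_row.2 hQ)))
        rintro rfl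
        exact hAB (mem_row.2 hQ)
  have hle : ∀ e, (∃ F, IsSeparator (X : Set (Point k)) (A, B) F e) →
      ((col X B).card - 1, (row X A).card - 1) ≤ e :=
    fun e ⟨F, hF⟩ => ⟨pred_card_col_le hF, pred_card_row_le hF⟩
  ext d
  rw [pointDegree, Set.mem_ofPred_eq, Set.mem_singleton_iff]
  exact ⟨fun hd => (hle d hd.prop).antisymm' (hd.le_of_le hsep (hle d hd.prop)),
    fun hd => hd ▸ ⟨hsep, fun e he _ => hle e he⟩⟩

theorem exists_isSeparator_of_encard_pointDegree {X : Finset (Point k)} {A B : ℙ k (Fin 2 → k)}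
    (hP : (A, B) ∈ X) (h : (pointDegree (X : Set (Point k)) (A, B)).encard = 1) :
    ∃ F d, IsSeparator (X : Set (Point k)) (A, B) F d ∧
      d.1 < (col X B).card ∧ d.2 < (row X A).card := by
  classical
  obtain ⟨d, hd⟩ := Set.encard_eq_one.1 h
  have hmin : ∀ F e, IsSeparator (X : Set (Point k)) (A, B) F e → d ≤ e := fun F e he => by
    obtain ⟨e', hle, he'⟩ := exists_minimal_le_of_wellFoundedLT
      (fun e => ∃ F, IsSeparator (X : Set (Point k)) (A, B) F e) e ⟨F, he⟩
    have : e' ∈ pointDegree (X : Set (Point k)) (A, B) := he'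
    rw [hd, Set.mem_singleton_iff] at this
    exact this ▸ hle
  have hdmem : d ∈ pointDegree (X : Set (Point k)) (A, B) := hd ▸ Set.mem_singleton d
  rw [pointDegree, Set.mem_ofPred_eq] at hdmem
  obtain ⟨F, hF⟩ := hdmem.prop
  -- Two covers by lines: `h1` is economical in `x` and `h2` in `y`. The unique minimal bidegree
  -- inherits both bounds.
  have h1 : ∀ A' B', (A', B') ∈ X → (A', B') ≠ (A, B) →
      A' ∈ (col X B).erase A ∨ B' ∈ (X.image Prod.snd).erase B := by
    intro A' B' hQ hne
    rw [Finset.mem_erase, Finset.mem_erase, mem_col]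
    by_cases hBB : B' = B
    · subst hBB
      exact Or.inl ⟨fun hA => hne (by rw [hA]), hQ⟩
    · exact Or.inr ⟨hBB, Finset.mem_image_of_mem Prod.snd hQ⟩
  have h2 : ∀ A' B', (A', B') ∈ X → (A', B') ≠ (A, B) →
      A' ∈ (X.image Prod.fst).erase A ∨ B' ∈ (row X A).erase B := by
    intro A' B' hQ hne
    rw [Finset.mem_erase, Finset.mem_erase, mem_row]
    by_cases hAA : A' = A
    · subst hAA
      exact Or.inr ⟨fun hB => hne (by rw [hB]), hQ⟩
    · exact Or.inl ⟨hAA, Finset.mem_image_of_mem Prod.fst hQ⟩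
  have h1' := hmin _ _ (isSeparator_prod (Finset.notMem_erase _ _) (Finset.notMem_erase _ _) h1)
  have h2' := hmin _ _ (isSeparator_prod (Finset.notMem_erase _ _) (Finset.notMem_erase _ _) h2)
  exact ⟨F, d, hF, h1'.1.trans_lt (Finset.card_erase_lt_of_mem (mem_col.2 hP)),
    h2'.2.trans_lt (Finset.card_erase_lt_of_mem (mem_row.2 hP))⟩

theorem hasNestedRows_of_encard_pointDegree {X : Finset (Point k)}
    (h : ∀ P ∈ X, (pointDegree (X : Set (Point k)) P).encard = 1) : HasNestedRows X := by
  classical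
  intro A A' hle B hB
  rw [mem_row] at hB ⊢
  obtain ⟨F, d, hF, h1, h2⟩ := exists_isSeparator_of_encard_pointDegree hB (h _ hB)
  by_contra hcon
  have hne : A' ≠ A := fun h => hcon (h ▸ hB)
  have hzero : ∀ A'' B', A'' ≠ A → (A'', B') ∈ X → eval (Sum.elim A''.rep B'.rep) F = 0 :=
    fun A'' B' h h' => hF.2.2 (A'', B') ⟨h', fun he => h (congrArg Prod.fst he)⟩
  have hA' : eval (Sum.elim A'.rep B.rep) F = 0 :=
    hF.1.eval_eq_zero_of_card_right (Z := row X A') (h2.trans_le hle)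
      (fun B' hB' => hzero _ _ hne (mem_row.1 hB')) _
  -- The new zero `(A', B)` makes up for the point `(A, B)` missing from the zeros on the line `y =
  -- B`.
  have hcard : d.1 < (insert A' ((col X B).erase A)).card := by
    have hnot : A' ∉ (col X B).erase A := fun h => hcon (mem_col.1 (Finset.mem_of_mem_erase h))
    rw [Finset.card_insert_of_notMem hnot, Finset.card_erase_of_mem (mem_col.2 hB)]
    omega
  refine hF.2.1 (hF.1.eval_eq_zero_of_card_left hcard (fun A'' hA'' => ?_) _)
  obtain h | h := Finset.mem_insert.1 hA''
  · rw [h]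
    exact hA'
  · rw [Finset.mem_erase, mem_col] at h
    exact hzero _ _ h.1 h.2

end Separators

/-! ### Regular sequences, depth and dimension in terms of ideals. -/

section RegularSequences

open RingTheory.Sequence

variable {R : Type*} [CommRing R]

theorem mk_mem_smul_top_iff (I K : Ideal R) (s : R) :
    (Submodule.mkQ I s ∈ (K • ⊤ : Submodule R (R ⧸ I))) ↔ s ∈ I ⊔ K := by
  have : (K • ⊤ : Submodule R (R ⧸ I)) = Submodule.map (Submodule.mkQ I) K := by
    rw [← Submodule.range_mkQ, ← Submodule.map_top, ← Submodule.map_smul'']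
    simp
  rw [this, ← Submodule.mem_comap, Submodule.comap_map_mkQ]

/-- `r` is a nonzerodivisor on `R/I`. -/
def IsRegularMod (I : Ideal R) (r : R) : Prop := ∀ s, r * s ∈ I → s ∈ I

theorem isSMulRegular_quotient_iff (I K : Ideal R) (r : R) :
    IsSMulRegular ((R ⧸ I) ⧸ (K • ⊤ : Submodule R (R ⧸ I))) r ↔ IsRegularMod (I ⊔ K) r := by
  rw [isSMulRegular_quotient_iff_mem_of_smul_mem, IsRegularMod]
  refine (Submodule.mkQ_surjective I).forall.trans (forall_congr' fun s => ?_)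
  rw [← map_smul, mk_mem_smul_top_iff, mk_mem_smul_top_iff, smul_eq_mul]

theorem IsRegularMod.of_isWeaklyRegular {I : Ideal R} {rs : List R}
    (h : IsWeaklyRegular (R ⧸ I) rs) {i : ℕ} (hi : i < rs.length) :
    IsRegularMod (I ⊔ Ideal.ofList (rs.take i)) rs[i] :=
  (isSMulRegular_quotient_iff _ _ _).1 (h.regular_mod_prev i hi)

theorem isRegular_pair {I : Ideal R} {f g : R} (hf : IsRegularMod I f)
    (hg : IsRegularMod (I ⊔ Ideal.span {f}) g) (h : (1 : R) ∉ I ⊔ Ideal.ofList [f, g]) :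
    IsRegular (R ⧸ I) [f, g] := by
  refine ⟨⟨fun i hi => ?_⟩, fun htop => h ?_⟩
  · rw [isSMulRegular_quotient_iff]
    match i, hi with
    | 0, _ => simpa using hf
    | 1, _ => simpa using hg
  · rw [← mk_mem_smul_top_iff, ← htop]
    trivial

theorem sup_ofList_ne_top {I : Ideal R} {rs : List R} (h : IsRegular (R ⧸ I) rs) :
    I ⊔ Ideal.ofList rs ≠ ⊤ := fun htop => h.top_ne_smul <| by
  refine (eq_top_iff.2 fun x _ => ?_).symm
  obtain ⟨s, rfl⟩ := Submodule.mkQ_surjective I x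
  rw [mk_mem_smul_top_iff, htop]
  trivial

/-- If `f, g` is a regular sequence on `R/I` and `h` is a nonzerodivisor on `R/I`, then no nonzero
element of `R/(I, h)` is killed by both `f` and `g`. -/
theorem mem_of_regular_pair {I : Ideal R} {f g h : R} (hf : IsRegularMod I f)
    (hg : IsRegularMod (I ⊔ Ideal.span {f}) g) (hh : IsRegularMod I h) {s : R}
    (h1 : f * s ∈ I ⊔ Ideal.span {h}) (h2 : g * s ∈ I ⊔ Ideal.span {h}) :
    s ∈ I ⊔ Ideal.span {h} := by
  rw [Submodule.mem_sup] at h1 h2 ⊢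
  obtain ⟨a, ha, b, hb, hab⟩ := h1
  obtain ⟨a', ha', b', hb', hab'⟩ := h2
  obtain ⟨t, rfl⟩ := Ideal.mem_span_singleton'.1 hb
  obtain ⟨u, rfl⟩ := Ideal.mem_span_singleton'.1 hb'
  -- From `f s = a + t h` and `g s = a' + u h`, eliminate `s` and cancel `h`; regularity of `g` then
  -- gives `t ≡ v f` modulo `I`, and `s - v h` is killed by `f`.
  have h3 : g * t - f * u ∈ I := hh _ <| by
    have : h * (g * t - f * u) = f * a' - g * a := by linear_combination g * hab - f * hab'
    rw [this]
    exact I.sub_mem (I.mul_mem_left _ ha') (I.mul_mem_left _ ha)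
  have h4 : t ∈ I ⊔ Ideal.span {f} := hg _ <| by
    rw [Submodule.mem_sup]
    exact ⟨_, h3, f * u, Ideal.mul_mem_right _ _ (Ideal.mem_span_singleton_self f), by ring⟩
  rw [Submodule.mem_sup] at h4
  obtain ⟨c, hc, e, he, hce⟩ := h4
  obtain ⟨v, rfl⟩ := Ideal.mem_span_singleton'.1 he
  refine ⟨s - v * h, hf _ ?_, v * h, Ideal.mul_mem_left _ _ (Ideal.mem_span_singleton_self h),
    by ring⟩
  have : f * (s - v * h) = a + c * h := by linear_combination -hab - h * hce
  rw [this]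
  exact I.add_mem ha (I.mul_mem_right _ hc)

/-- If `R/I` has a regular sequence of length two in `𝔪`, then `R/(I, h)` has no nonzero element
killed by a power of `𝔪`, for every nonzerodivisor `h` on `R/I`. -/
theorem mem_of_le_radical_colon [IsNoetherianRing R] {I 𝔪 : Ideal R} {f g h : R} (hfm : f ∈ 𝔪)
    (hgm : g ∈ 𝔪) (hf : IsRegularMod I f) (hg : IsRegularMod (I ⊔ Ideal.span {f}) g)
    (hh : IsRegularMod I h) {s : R} {K : Ideal R}
    (hK : ∀ a ∈ K, a * s ∈ I ⊔ Ideal.span {h}) (hm : 𝔪 ≤ K.radical) :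
    s ∈ I ⊔ Ideal.span {h} := by
  obtain ⟨n, hn⟩ := Ideal.exists_radical_pow_le_of_fg K (IsNoetherian.noetherian _)
  replace hn : ∀ a ∈ 𝔪 ^ n, a * s ∈ I ⊔ Ideal.span {h} :=
    fun a ha => hK a (hn (Ideal.pow_right_mono hm n ha))
  -- One factor of `𝔪` is peeled off at a time, since `f` and `g` both lie in `𝔪`.
  induction n with
  | zero => simpa using hn 1 (by simp)
  | succ n ih =>
    refine ih fun a ha => mem_of_regular_pair hf hg hh ?_ ?_
    · rw [← mul_assoc]
      exact hn _ (by rw [pow_succ']; exact Ideal.mul_mem_mul hfm ha)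
    · rw [← mul_assoc]
      exact hn _ (by rw [pow_succ']; exact Ideal.mul_mem_mul hgm ha)

theorem IsRegularMod.ringKrullDim_succ_le {I : Ideal R} {r : R} (h : IsRegularMod I r)
    {K : Ideal R} (hIK : I ≤ K) (hr : r ∈ K) : ringKrullDim (R ⧸ K) + 1 ≤ ringKrullDim (R ⧸ I) := by
  refine ringKrullDim_succ_le_of_surjective (Ideal.Quotient.factor hIK)
    (Ideal.Quotient.factor_surjective hIK) (r := Ideal.Quotient.mk I r) ?_ ?_
  · rw [mem_nonZeroDivisors_iff_right]
    intro x hx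
    obtain ⟨s, rfl⟩ := Ideal.Quotient.mk_surjective x
    rw [← map_mul, Ideal.Quotient.eq_zero_iff_mem] at hx
    rw [Ideal.Quotient.eq_zero_iff_mem]
    exact h s (by rwa [mul_comm])
  · rw [Ideal.Quotient.factor_mk, Ideal.Quotient.eq_zero_iff_mem]
    exact hr

/-- A regular sequence on `R/I` has at most as many members as the dimension of `R/I`. -/
theorem length_le_ringKrullDim {I : Ideal R} {rs : List R} (h : IsRegular (R ⧸ I) rs) :
    (rs.length : WithBot ℕ∞) ≤ ringKrullDim (R ⧸ I) := by
  have key : ∀ n ≤ rs.length,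
      ringKrullDim (R ⧸ (I ⊔ Ideal.ofList (rs.take n))) + n ≤ ringKrullDim (R ⧸ I) := by
    intro n
    induction n with
    | zero =>
      intro _
      simp only [List.take_zero, Nat.cast_zero, add_zero]
      exact ringKrullDim_le_of_surjective (Ideal.Quotient.factor le_sup_left)
        (Ideal.Quotient.factor_surjective le_sup_left)
    | succ n ih =>
      intro hn
      refine le_trans ?_ (ih (by omega))
      have := (IsRegularMod.of_isWeaklyRegular h.toIsWeaklyRegular hn).ringKrullDim_succ_le
        (K := I ⊔ Ideal.ofList (rs.take (n + 1))) ?_ ?_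
      · rw [Nat.cast_succ, add_comm (n : WithBot ℕ∞), ← add_assoc]
        gcongr
      · rw [← List.take_append_getElem hn, Ideal.ofList_append]
        exact sup_le_sup_left le_sup_left _
      · refine Ideal.mem_sup_right (Ideal.subset_span ?_)
        have := List.mem_append_right (rs.take n) (List.mem_singleton_self rs[n])
        rwa [List.take_append_getElem hn] at this
  have h0 : Nontrivial (R ⧸ (I ⊔ Ideal.ofList rs)) :=
    Ideal.Quotient.nontrivial_iff.2 (sup_ofList_ne_top h)
  refine le_trans ?_ (key _ le_rfl)
  rw [List.take_length]
  exact le_add_of_nonneg_left ringKrullDim_nonneg_of_nontrivial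

theorem ringKrullDim_quotient_add_two_le [IsDomain R] {I : Ideal R} {f g : R}
    (hf : f ∈ I) (hg : g ∈ I) (hf0 : f ≠ 0) (hfg : ∀ s, f ∣ g * s → f ∣ s) :
    ringKrullDim (R ⧸ I) + 2 ≤ ringKrullDim R := by
  have h1 : ringKrullDim (R ⧸ Ideal.span {f}) + 1 ≤ ringKrullDim R :=
    ringKrullDim_quotient_succ_le_of_nonZeroDivisor (mem_nonZeroDivisors_of_ne_zero hf0)
  have h2 : IsRegularMod (Ideal.span {f}) g := fun s => by
    simpa only [Ideal.mem_span_singleton] using hfg s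
  have h3 := h2.ringKrullDim_succ_le ((Ideal.span_singleton_le_iff_mem I).2 hf) hg
  calc ringKrullDim (R ⧸ I) + 2 = ringKrullDim (R ⧸ I) + 1 + 1 := by
        rw [add_assoc, one_add_one_eq_two]
    _ ≤ _ := (add_le_add_left h3 1).trans h1

end RegularSequences

/-! ### Nested rows and the ACM property. -/

section Points

variable {k : Type*} [Field k] {X : Finset (Point k)}

theorem infinite_projectiveLine [Infinite k] : Infinite (ℙ k (Fin 2 → k)) := by
  have h : ∀ t : k, (![1, t] : Fin 2 → k) ≠ 0 := fun t h => one_ne_zero (congrFun h 0)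
  refine Infinite.of_injective (fun t => Projectivization.mk k ![1, t] (h t)) fun s t hst => ?_
  rw [Projectivization.mk_eq_mk_iff'] at hst
  obtain ⟨a, ha⟩ := hst
  have h0 := congrFun ha 0
  have h1 := congrFun ha 1
  simp only [Pi.smul_apply, smul_eq_mul, Matrix.cons_val_zero, Matrix.cons_val_one, mul_one]
    at h0 h1
  rw [← h1, h0, one_mul]

theorem eval_eq_zero_of_mem_idealOfPoints {F : CoordRing k}
    (hF : F ∈ idealOfPoints (X : Set (Point k))) {A B : ℙ k (Fin 2 → k)} (hP : (A, B) ∈ X) :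
    eval (Sum.elim A.rep B.rep) F = 0 := by
  have : idealOfPoints (X : Set (Point k)) ≤ RingHom.ker (eval (Sum.elim A.rep B.rep)) :=
    Ideal.span_le.2 fun G hG => RingHom.mem_ker.2 (hG.2 (A, B) hP)
  exact this hF

theorem IsForm.mem_idealOfPoints {F : CoordRing k} {d : ℕ × ℕ} (hF : IsForm F d)
    (h : ∀ A B, (A, B) ∈ X → eval (Sum.elim A.rep B.rep) F = 0) :
    F ∈ idealOfPoints (X : Set (Point k)) :=
  Ideal.subset_span ⟨⟨d, hF⟩, fun P hP => h P.1 P.2 hP⟩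

theorem idealOfPoints_sup_span (L : CoordRing k) :
    idealOfPoints (X : Set (Point k)) ⊔ Ideal.span {L} =
      Ideal.span ({F | (∃ d, IsForm F d) ∧ ∀ P ∈ (X : Set (Point k)), VanishesAt F P} ∪ {L}) :=
  (Ideal.span_union _ _).symm

/-- The linear form is nonzero at every point of `X`, so it cancels from the vanishing conditions.
-/
theorem isRegularMod_linY {B₀ : ℙ k (Fin 2 → k)} (hB₀ : ∀ A, (A, B₀) ∉ X) :
    IsRegularMod (idealOfPoints (X : Set (Point k))) (linY B₀.rep) := by
  refine fun F => mem_span_of_mul_mem (fun F hF => hF.1) (isForm_linY _) fun F d hF h => ?_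
  refine hF.mem_idealOfPoints fun A B hP => ?_
  have := eval_eq_zero_of_mem_idealOfPoints h hP
  rw [map_mul, mul_eq_zero, eval_linY, det_rep_eq_zero_iff] at this
  exact this.resolve_left fun h => hB₀ A (h ▸ hP)

theorem substY_linY (w b : Fin 2 → k) : substY w (linY b) = C (b 1 * w 0 - b 0 * w 1) := by
  simp [substY, linY]

/-- Modulo the linear form of a point `B₀` of the line, products of linear forms of other points
are powers of a fixed linear form. -/
theorem linY_pow_mul_mem {J : Ideal (CoordRing k)} {B₀ : ℙ k (Fin 2 → k)} {m : Fin 2 → k}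
    (hm : m 1 * B₀.rep 0 - m 0 * B₀.rep 1 = 1) (hJ : linY B₀.rep ∈ J)
    {Z : Finset (ℙ k (Fin 2 → k))} (hZ : B₀ ∉ Z) {j : ℕ} (hj : Z.card ≤ j) {G : CoordRing k}
    (hG : (∏ B ∈ Z, linY B.rep) * G ∈ J) : linY m ^ j * G ∈ J := by
  classical
  suffices h : linY m ^ Z.card * G ∈ J by
    rw [← Nat.sub_add_cancel hj, pow_add, mul_assoc]
    exact J.mul_mem_left _ h
  clear hj
  induction Z using Finset.induction_on generalizing G with
  | empty => simpa using hG
  | insert B Z hB ih =>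
    rw [Finset.prod_insert hB, mul_comm (linY B.rep), mul_assoc] at hG
    have h := ih (fun h => hZ (Finset.mem_insert_of_mem h)) hG
    have hne : B.rep 1 * B₀.rep 0 - B.rep 0 * B₀.rep 1 ≠ 0 := fun h =>
      hZ (by rw [(det_rep_eq_zero_iff _ _).1 h]; exact Finset.mem_insert_self _ _)
    have h2 := (isForm_linY B.rep).sub_mem_span_linY hm
    rw [substY_linY] at h2
    replace h2 := (Ideal.span_singleton_le_iff_mem J).2 hJ h2
    -- This is the value of `linY B.rep` at `B₀`, so `linY B.rep ≡ c * linY m` modulo `linY B₀.rep`.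
    set c := B.rep 1 * B₀.rep 0 - B.rep 0 * B₀.rep 1
    have hc : C c⁻¹ * C c = (1 : CoordRing k) := by rw [← C_mul, inv_mul_cancel₀ hne, C_1]
    rw [Finset.card_insert_of_notMem hB]
    have : linY m ^ (Z.card + 1) * G = C c⁻¹ * (linY m ^ Z.card * (linY B.rep * G)
        - linY m ^ Z.card * G * (linY B.rep - linY m ^ 1 * C c)) := by
      linear_combination -(linY m ^ (Z.card + 1) * G) * hc
    rw [this]
    exact J.mul_mem_left _ (J.sub_mem h (J.mul_mem_left _ h2))

/-- A form that lies in `I + (l)` agrees with a form of `I` of the same degree modulo `l`. -/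
theorem IsForm.exists_sub_mem_span {F : CoordRing k} {d : ℕ × ℕ} (hF : IsForm F d)
    {L : CoordRing k} {e : ℕ × ℕ} (hL : IsForm L e)
    (h : F ∈ idealOfPoints (X : Set (Point k)) ⊔ Ideal.span {L}) :
    ∃ H ∈ idealOfPoints (X : Set (Point k)), IsForm H d ∧ F - H ∈ Ideal.span {L} := by
  rw [Submodule.mem_sup] at h
  obtain ⟨H, hH, G, hG, hHG⟩ := h
  refine ⟨component d H, component_mem_span (fun F hF => hF.1) hH d, isForm_component d H, ?_⟩
  have : F - component d H = component d G := by
    rw [← hF.component_eq, ← hHG, map_add, add_sub_cancel_left]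
  rw [this]
  refine component_mem_span ?_ hG d
  rintro _ rfl
  exact ⟨e, hL⟩

theorem eval_eq_of_sub_mem_span_linY {F G : CoordRing k} {w : Fin 2 → k}
    (h : F - G ∈ Ideal.span {linY w}) (v : Fin 2 → k) :
    eval (Sum.elim v w) F = eval (Sum.elim v w) G := by
  obtain ⟨q, hq⟩ := Ideal.mem_span_singleton'.1 h
  have := congrArg (eval (Sum.elim v w)) hq
  rw [map_mul, map_sub, eval_linY] at this
  linear_combination -this

theorem IsForm.eval_eq_zero_of_mem_sup {F : CoordRing k} {d : ℕ × ℕ} (hF : IsForm F d)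
    {B₀ A : ℙ k (Fin 2 → k)}
    (h : F ∈ idealOfPoints (X : Set (Point k)) ⊔ Ideal.span {linY B₀.rep})
    (hA : d.2 < (row X A).card) : eval (Sum.elim A.rep B₀.rep) F = 0 := by
  obtain ⟨H, hH, hHd, hFH⟩ := hF.exists_sub_mem_span (isForm_linY _) h
  rw [eval_eq_of_sub_mem_span_linY hFH]
  exact hHd.eval_eq_zero_of_card_right hA
    (fun B hB => eval_eq_zero_of_mem_idealOfPoints hH (mem_row.1 hB)) _

open Classical in
theorem prod_mul_prod_mem_idealOfPoints {Z W : Finset (ℙ k (Fin 2 → k))}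
    (h : ∀ A B, (A, B) ∈ X → A ∈ Z ∨ B ∈ W) :
    (∏ B ∈ W, linY B.rep) * ∏ A ∈ Z, linX A.rep ∈ idealOfPoints (X : Set (Point k)) := by
  have hF : IsForm _ _ := (isForm_prod_linY W).mul (isForm_prod_linX Z)
  refine hF.mem_idealOfPoints fun A B hP => ?_
  rw [map_mul, mul_eq_zero, eval_prod_linX_eq_zero_iff, eval_prod_linY_eq_zero_iff]
  exact (h A B hP).symm

/-- Take for `Z` the largest row with at most `j` points, or `∅` if there is none. -/
theorem HasNestedRows.exists_row_subset (h : HasNestedRows X) (j : ℕ) :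
    ∃ Z : Finset (ℙ k (Fin 2 → k)), Z.card ≤ j ∧ (∀ B ∈ Z, ∃ A, (A, B) ∈ X) ∧
      ∀ A, (row X A).card ≤ j → row X A ⊆ Z := by
  classical
  let T := (X.image Prod.fst).filter fun A => (row X A).card ≤ j
  have hT : ∀ A, (row X A).card ≤ j → (row X A).Nonempty → A ∈ T := fun A hA ⟨B, hB⟩ =>
    Finset.mem_filter.2 ⟨Finset.mem_image.2 ⟨(A, B), mem_row.1 hB, rfl⟩, hA⟩
  rcases T.eq_empty_or_nonempty with h0 | h0
  · refine ⟨∅, by simp, by simp, fun A hA => ?_⟩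
    by_contra hne
    have := hT A hA (Finset.nonempty_iff_ne_empty.2 fun h => hne (by rw [h]))
    simp [h0] at this
  · obtain ⟨A₁, hA₁, hmax⟩ := T.exists_max_image (fun A => (row X A).card) h0
    refine ⟨row X A₁, (Finset.mem_filter.1 hA₁).2, fun B hB => ⟨A₁, mem_row.1 hB⟩,
      fun A hA => ?_⟩
    rcases (row X A).eq_empty_or_nonempty with he | hne
    · simp [he]
    · exact h _ _ (hmax A (hT A hA hne))

/-- Converse of `IsForm.eval_eq_zero_of_mem_sup`. Lines through `Z` cover the small rows and lines
over `T` the large ones. Modulo `linY B₀.rep` this yields `linY m ^ d.2 * ∏ linX ∈ J`, which divides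
`linY m ^ d.2 * F(x, B₀) ≡ F`. -/
theorem HasNestedRows.mem_sup_of_eval_eq_zero (h : HasNestedRows X) {B₀ : ℙ k (Fin 2 → k)}
    (hB₀ : ∀ A, (A, B₀) ∉ X) {F : CoordRing k} {d : ℕ × ℕ} (hF : IsForm F d)
    (hz : ∀ A, d.2 < (row X A).card → eval (Sum.elim A.rep B₀.rep) F = 0) :
    F ∈ idealOfPoints (X : Set (Point k)) ⊔ Ideal.span {linY B₀.rep} := by
  classical
  set J := idealOfPoints (X : Set (Point k)) ⊔ Ideal.span {linY B₀.rep} with hJ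
  obtain ⟨m, hm⟩ := exists_dual B₀.rep_nonzero
  have hl : linY B₀.rep ∈ J := Ideal.mem_sup_right (Ideal.mem_span_singleton_self _)
  obtain ⟨Z, hZj, hZX, hZ⟩ := h.exists_row_subset d.2
  let T := (X.image Prod.fst).filter fun A => d.2 < (row X A).card
  have hprod : (∏ B ∈ Z, linY B.rep) * ∏ A ∈ T, linX A.rep ∈ J := by
    refine Ideal.mem_sup_left (prod_mul_prod_mem_idealOfPoints fun A B hP => ?_)
    by_cases hA : d.2 < (row X A).card
    · exact Or.inl (Finset.mem_filter.2 ⟨Finset.mem_image.2 ⟨_, hP, rfl⟩, hA⟩)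
    · exact Or.inr (hZ A (not_lt.1 hA) (mem_row.2 hP))
  have hpow := linY_pow_mul_mem hm hl (fun h => (hZX _ h).elim hB₀) hZj hprod
  obtain ⟨Q, hQ⟩ := hF.prod_linX_dvd_substY (w := B₀.rep) (Z := T)
    fun A hA => hz A (Finset.mem_filter.1 hA).2
  have hsub := (Ideal.span_singleton_le_iff_mem J).2 hl (hF.sub_mem_span_linY hm)
  rw [hQ, ← mul_assoc] at hsub
  exact (Submodule.sub_mem_iff_left J (J.mul_mem_right Q hpow)).1 hsub

theorem HasNestedRows.isRegularMod_linX (h : HasNestedRows X) {A₀ B₀ : ℙ k (Fin 2 → k)}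
    (hA₀ : ∀ B, (A₀, B) ∉ X) (hB₀ : ∀ A, (A, B₀) ∉ X) :
    IsRegularMod (idealOfPoints (X : Set (Point k)) ⊔ Ideal.span {linY B₀.rep})
      (linX A₀.rep) := by
  intro F hF
  rw [idealOfPoints_sup_span] at hF ⊢
  refine mem_span_of_mul_mem ?_ (isForm_linX A₀.rep) (fun F d hF hL => ?_) hF
  · rintro F (hF | rfl)
    · exact hF.1
    · exact ⟨_, isForm_linY _⟩
  · rw [← idealOfPoints_sup_span] at hL ⊢
    refine h.mem_sup_of_eval_eq_zero hB₀ hF fun A hA => ?_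
    have h0 := IsForm.eval_eq_zero_of_mem_sup (A := A) ((isForm_linX A₀.rep).mul hF) hL
      (by simpa using hA)
    rw [map_mul, mul_eq_zero, eval_linX, det_rep_eq_zero_iff] at h0
    refine h0.resolve_left fun h => ?_
    obtain ⟨B, hB⟩ := Finset.card_pos.1 (pos_of_gt hA)
    exact hA₀ B (h ▸ mem_row.1 hB)

theorem X_mem_irrelevantIdeal (z : Fin 2 ⊕ Fin 2) :
    (MvPolynomial.X z : CoordRing k) ∈ irrelevantIdeal k :=
  Ideal.subset_span ⟨z, rfl⟩

theorem linX_mem_irrelevantIdeal (v : Fin 2 → k) : linX v ∈ irrelevantIdeal k :=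
  Ideal.sub_mem _ (Ideal.mul_mem_left _ _ (X_mem_irrelevantIdeal _))
    (Ideal.mul_mem_left _ _ (X_mem_irrelevantIdeal _))

theorem linY_mem_irrelevantIdeal (v : Fin 2 → k) : linY v ∈ irrelevantIdeal k :=
  Ideal.sub_mem _ (Ideal.mul_mem_left _ _ (X_mem_irrelevantIdeal _))
    (Ideal.mul_mem_left _ _ (X_mem_irrelevantIdeal _))

theorem irrelevantIdeal_le_ker : irrelevantIdeal k ≤ RingHom.ker (eval (0 : Fin 2 ⊕ Fin 2 → k)) :=
  Ideal.span_le.2 <| by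
    rintro _ ⟨z, rfl⟩
    simp

theorem idealOfPoints_le_ker (hX : X.Nonempty) :
    idealOfPoints (X : Set (Point k)) ≤ RingHom.ker (eval (0 : Fin 2 ⊕ Fin 2 → k)) := by
  refine Ideal.span_le.2 ?_
  rintro F ⟨⟨d, hF⟩, hFX⟩
  obtain ⟨P, hP⟩ := hX
  have h := hF.eval_smul 0 0 P.1.rep P.2.rep
  have hF0 : eval (Sum.elim P.1.rep P.2.rep) F = 0 := hFX P hP
  have h0 : Sum.elim (0 : Fin 2 → k) (0 : Fin 2 → k) = 0 := by
    ext z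
    rcases z with z | z <;> rfl
  rw [hF0, mul_zero, zero_smul, zero_smul, h0] at h
  exact h

/-- The ideal contains a product of forms in `x` and a product of forms in `y`, which are coprime.
-/
theorem ringKrullDim_quotient_idealOfPoints_add_two_le :
    ringKrullDim (CoordRing k ⧸ idealOfPoints (X : Set (Point k))) + 2 ≤ 4 := by
  classical
  have hf := prod_mul_prod_mem_idealOfPoints (X := X) (Z := X.image Prod.fst) (W := ∅)
    fun A B hP => Or.inl (Finset.mem_image.2 ⟨_, hP, rfl⟩)
  have hg := prod_mul_prod_mem_idealOfPoints (X := X) (Z := ∅) (W := X.image Prod.snd)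
    fun A B hP => Or.inr (Finset.mem_image.2 ⟨_, hP, rfl⟩)
  rw [Finset.prod_empty, one_mul] at hf
  rw [Finset.prod_empty, mul_one] at hg
  have hrel : IsRelPrime (∏ A ∈ X.image Prod.fst, linX A.rep)
      (∏ B ∈ X.image Prod.snd, linY B.rep) :=
    IsRelPrime.prod_left fun A _ => IsRelPrime.prod_right fun B _ => isRelPrime_linX_linY A B
  refine (ringKrullDim_quotient_add_two_le hf hg
    (Finset.prod_ne_zero_iff.2 fun A _ => (prime_linX A.rep_nonzero).ne_zero)
    fun s => hrel.dvd_of_dvd_mul_left).trans ?_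
  rw [MvPolynomial.ringKrullDim_of_isNoetherianRing, ringKrullDim_eq_zero_of_field]
  simp

theorem HasNestedRows.isACM [Infinite k] (h : HasNestedRows X) (hX : X.Nonempty) :
    IsACM (X : Set (Point k)) := by
  classical
  have := infinite_projectiveLine (k := k)
  obtain ⟨A₀, hA₀⟩ := Infinite.exists_notMem_finset (X.image Prod.fst)
  obtain ⟨B₀, hB₀⟩ := Infinite.exists_notMem_finset (X.image Prod.snd)
  replace hA₀ : ∀ B, (A₀, B) ∉ X := fun B hB => hA₀ (Finset.mem_image.2 ⟨_, hB, rfl⟩)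
  replace hB₀ : ∀ A, (A, B₀) ∉ X := fun A hA => hB₀ (Finset.mem_image.2 ⟨_, hA, rfl⟩)
  refine le_antisymm (iSup_le fun rs => ?_) ?_
  · have h1 := length_le_ringKrullDim rs.2.2
    have h2 := (add_le_add_left h1 2).trans ringKrullDim_quotient_idealOfPoints_add_two_le
    have h3 : rs.1.length + 2 ≤ 4 := by exact_mod_cast h2
    have h4 : rs.1.length ≤ 2 := by omega
    exact_mod_cast h4
  · have hmem : ∀ r ∈ [linY B₀.rep, linX A₀.rep], r ∈ irrelevantIdeal k := by
      simp [linX_mem_irrelevantIdeal, linY_mem_irrelevantIdeal]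
    refine le_iSup_of_le ⟨[linY B₀.rep, linX A₀.rep], hmem, isRegular_pair (isRegularMod_linY hB₀)
      (h.isRegularMod_linX hA₀ hB₀) fun h1 => ?_⟩ le_rfl
    have : (1 : CoordRing k) ∈ RingHom.ker (eval (0 : Fin 2 ⊕ Fin 2 → k)) :=
      sup_le (idealOfPoints_le_ker hX)
        ((Ideal.span_le.2 fun r hr => hmem r hr).trans irrelevantIdeal_le_ker) h1
    simp at this

theorem irrelevantIdeal_le_of_mem {p : Ideal (CoordRing k)} {A A' B B' : ℙ k (Fin 2 → k)}
    (hA : A ≠ A') (hB : B ≠ B') (h1 : linX A.rep ∈ p) (h2 : linX A'.rep ∈ p)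
    (h3 : linY B.rep ∈ p) (h4 : linY B'.rep ∈ p) : irrelevantIdeal k ≤ p := by
  have key : ∀ (C₁ C₂ : ℙ k (Fin 2 → k)) (x y : CoordRing k), C₁ ≠ C₂ →
      C (C₁.rep 1) * x - C (C₁.rep 0) * y ∈ p → C (C₂.rep 1) * x - C (C₂.rep 0) * y ∈ p →
      x ∈ p ∧ y ∈ p := by
    intro C₁ C₂ x y hne h h'
    have hc : C₁.rep 1 * C₂.rep 0 - C₁.rep 0 * C₂.rep 1 ≠ 0 :=
      fun h => hne ((det_rep_eq_zero_iff _ _).1 h)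
    set c := C₁.rep 1 * C₂.rep 0 - C₁.rep 0 * C₂.rep 1 with hcdef
    have hcc : C c⁻¹ * (C (C₁.rep 1) * C (C₂.rep 0) - C (C₁.rep 0) * C (C₂.rep 1))
        = (1 : CoordRing k) := by
      rw [← C_mul, ← C_mul, ← C_sub, ← C_mul, ← hcdef, inv_mul_cancel₀ hc, C_1]
    -- Cramer's rule for two independent linear forms.
    have hx : x = C c⁻¹ * (C (C₂.rep 0) * (C (C₁.rep 1) * x - C (C₁.rep 0) * y)
        - C (C₁.rep 0) * (C (C₂.rep 1) * x - C (C₂.rep 0) * y)) := by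
      linear_combination -x * hcc
    have hy : y = C c⁻¹ * (C (C₂.rep 1) * (C (C₁.rep 1) * x - C (C₁.rep 0) * y)
        - C (C₁.rep 1) * (C (C₂.rep 1) * x - C (C₂.rep 0) * y)) := by
      linear_combination -y * hcc
    constructor
    · rw [hx]
      exact p.mul_mem_left _ (p.sub_mem (p.mul_mem_left _ h) (p.mul_mem_left _ h'))
    · rw [hy]
      exact p.mul_mem_left _ (p.sub_mem (p.mul_mem_left _ h) (p.mul_mem_left _ h'))
  have hx := key _ _ _ _ hA h1 h2
  have hy := key _ _ _ _ hB h3 h4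
  refine Ideal.span_le.2 ?_
  rintro _ ⟨z | z, rfl⟩ <;> fin_cases z
  exacts [hx.1, hx.2, hy.1, hy.2]

/-- The form `m ^ j * ∏ linX A''`, over the rows with more than `j` points, is killed modulo
`I + (l)` by a power of the irrelevant ideal. -/
theorem irrelevantIdeal_le_radical {B₀ : ℙ k (Fin 2 → k)} (hB₀ : ∀ A, (A, B₀) ∉ X)
    {j : ℕ} {m : Fin 2 → k} (hm : m 1 * B₀.rep 0 - m 0 * B₀.rep 1 = 1)
    {T U : Finset (ℙ k (Fin 2 → k))} (hTU : Disjoint T U) (hU : ∀ A ∈ U, (row X A).card ≤ j)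
    (hne : U.Nonempty) (hX : ∀ A B, (A, B) ∈ X → A ∈ T ∨ A ∈ U) {K : Ideal (CoordRing k)}
    (hK : ∀ a, a * (linY m ^ j * ∏ A ∈ T, linX A.rep) ∈
      idealOfPoints (X : Set (Point k)) ⊔ Ideal.span {linY B₀.rep} → a ∈ K) :
    irrelevantIdeal k ≤ K.radical := by
  classical
  set J := idealOfPoints (X : Set (Point k)) ⊔ Ideal.span {linY B₀.rep} with hJ
  have hl : linY B₀.rep ∈ J := Ideal.mem_sup_right (Ideal.mem_span_singleton_self _)
  rw [Ideal.radical_eq_sInf]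
  refine le_sInf ?_
  rintro p ⟨hKp, hp⟩
  have hJp : J ≤ p := fun a ha => hKp (hK a (J.mul_mem_right _ ha))
  have hY : ∏ B ∈ X.image Prod.snd, linY B.rep ∈ p := by
    have := prod_mul_prod_mem_idealOfPoints (X := X) (Z := ∅) (W := X.image Prod.snd)
      fun A B hP => Or.inr (Finset.mem_image.2 ⟨_, hP, rfl⟩)
    rw [Finset.prod_empty, mul_one] at this
    exact hJp (Ideal.mem_sup_left this)
  obtain ⟨B, hB, hBp⟩ := (hp.prod_mem_iff).1 hY
  have hBne : B₀ ≠ B := by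
    rintro rfl
    obtain ⟨Q, hQ, hQB⟩ := Finset.mem_image.1 hB
    exact hB₀ Q.1 (hQB ▸ hQ)
  -- Leave out the factor of `A`: its row is covered by at most `j` lines in `y`, whose forms turn
  -- into `linY m ^ j`. Used twice, this gives two distinct points with `linX` in `p`.
  have hXp : ∀ A ∈ U, ∃ A' ∈ U, A' ≠ A ∧ linX A'.rep ∈ p := by
    intro A hA
    have h1 : ∏ A' ∈ U.erase A, linX A'.rep ∈ p := by
      refine hKp (hK _ ?_)
      have h2 := linY_pow_mul_mem hm hl (Z := row X A) (j := j) (fun h => hB₀ A (mem_row.1 h))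
        (hU A hA) (Ideal.mem_sup_left (prod_mul_prod_mem_idealOfPoints (X := X)
          (Z := T ∪ U.erase A) (W := row X A) fun A' B' hP => ?_))
      · rw [Finset.prod_union (hTU.mono_right (Finset.erase_subset _ _))] at h2
        convert h2 using 1
        ring
      · by_cases hAA : A' = A
        · exact Or.inr (mem_row.2 (hAA ▸ hP))
        · refine Or.inl (Finset.mem_union.2 ((hX A' B' hP).imp_right fun h => ?_))
          exact Finset.mem_erase.2 ⟨hAA, h⟩
    obtain ⟨A', hA', hA'p⟩ := (hp.prod_mem_iff).1 h1
    exact ⟨A', Finset.mem_of_mem_erase hA', Finset.ne_of_mem_erase hA', hA'p⟩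
  obtain ⟨A, hA⟩ := hne
  obtain ⟨A₁, hA₁, -, h1⟩ := hXp A hA
  obtain ⟨A₂, -, hne2, h2⟩ := hXp A₁ hA₁
  exact irrelevantIdeal_le_of_mem hne2 hBne h2 h1 (hJp hl) hBp

theorem exists_regular_pair (h : IsACM (X : Set (Point k))) :
    ∃ f ∈ irrelevantIdeal k, ∃ g ∈ irrelevantIdeal k,
      IsRegularMod (idealOfPoints (X : Set (Point k))) f ∧
      IsRegularMod (idealOfPoints (X : Set (Point k)) ⊔ Ideal.span {f}) g := by
  by_contra! hcon
  have : depth (irrelevantIdeal k) (CoordRing k ⧸ idealOfPoints (X : Set (Point k))) ≤ 1 := by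
    refine iSup_le ?_
    rintro ⟨rs, hrs, hreg⟩
    match rs, hrs, hreg with
    | [], _, _ => simp
    | [_], _, _ => simp
    | f :: g :: rs, hrs, hreg =>
      refine absurd ?_ (hcon f (hrs f (by simp)) g (hrs g (by simp)) ?_)
      · simpa using IsRegularMod.of_isWeaklyRegular hreg.toIsWeaklyRegular
          (show 1 < (f :: g :: rs).length by simp)
      · simpa using IsRegularMod.of_isWeaklyRegular hreg.toIsWeaklyRegular
          (show 0 < (f :: g :: rs).length by simp)
  rw [h] at this
  exact absurd this (by decide)

theorem IsACM.hasNestedRows [Infinite k] (h : IsACM (X : Set (Point k))) : HasNestedRows X := by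
  classical
  intro A A' hle B hB
  by_contra hcon
  obtain ⟨f, hf, g, hg, hfreg, hgreg⟩ := exists_regular_pair h
  have := infinite_projectiveLine (k := k)
  obtain ⟨B₀, hB₀⟩ := Infinite.exists_notMem_finset (X.image Prod.snd)
  replace hB₀ : ∀ A, (A, B₀) ∉ X := fun A hA => hB₀ (Finset.mem_image.2 ⟨_, hA, rfl⟩)
  obtain ⟨m, hm⟩ := exists_dual B₀.rep_nonzero
  set j := (row X A').card with hj
  let T := (X.image Prod.fst).filter fun A => j < (row X A).card
  let U := (X.image Prod.fst).filter fun A => (row X A).card ≤ j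
  have hrow : ∀ A'' B'', (A'', B'') ∈ X → A'' ∈ X.image Prod.fst :=
    fun A'' B'' h => Finset.mem_image.2 ⟨_, h, rfl⟩
  have hTU : Disjoint T U := Finset.disjoint_left.2 fun A h1 h2 =>
    (Finset.mem_filter.1 h1).2.not_ge (Finset.mem_filter.1 h2).2
  have hs : linY m ^ j * ∏ A ∈ T, linX A.rep ∈
      idealOfPoints (X : Set (Point k)) ⊔ Ideal.span {linY B₀.rep} := by
    refine mem_of_le_radical_colon hf hg hfreg hgreg (isRegularMod_linY hB₀)
      -- This comap is the colon ideal of the form.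
      (K := Submodule.comap (LinearMap.mulRight (CoordRing k) (linY m ^ j * ∏ A ∈ T, linX A.rep))
        (idealOfPoints (X : Set (Point k)) ⊔ Ideal.span {linY B₀.rep}))
      (fun a ha => ha) ?_
    refine irrelevantIdeal_le_radical hB₀ hm hTU (fun A hA => (Finset.mem_filter.1 hA).2)
      ⟨A, Finset.mem_filter.2 ⟨hrow A B (mem_row.1 hB), hle⟩⟩ (fun A'' B'' hP => ?_)
      (fun a ha => ha)
    rcases lt_or_ge j (row X A'').card with h | h
    · exact Or.inl (Finset.mem_filter.2 ⟨hrow _ _ hP, h⟩)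
    · exact Or.inr (Finset.mem_filter.2 ⟨hrow _ _ hP, h⟩)
  have hsform : IsForm (linY m ^ j * ∏ A ∈ T, linX A.rep) (T.card, j) := by
    have := ((isForm_linY m).pow j).mul (isForm_prod_linX T)
    simpa [IsForm] using this
  obtain ⟨H, hH, hHd, hsH⟩ := hsform.exists_sub_mem_span (isForm_linY _) hs
  have hHX : ∀ A B, (A, B) ∈ X → eval (Sum.elim A.rep B.rep) H = 0 :=
    fun A B hP => eval_eq_zero_of_mem_idealOfPoints hH hP
  have hAT : A ∉ T := fun h => (Finset.mem_filter.1 h).2.not_ge hle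
  have hA'T : A' ∉ T := fun h => (Finset.mem_filter.1 h).2.not_ge le_rfl
  -- `H` vanishes on the lines over `T` and at `(A, B)`: that is `T.card + 1` zeros on `y = B`. With
  -- the new zero `(A', B)`, the line `x = A'` carries `j + 1` zeros, so `H` vanishes at `(A', B₀)`,
  -- where the product does not.
  have hA'B : eval (Sum.elim A'.rep B.rep) H = 0 := by
    refine hHd.eval_eq_zero_of_card_left (Z := insert A T) ?_ (fun A'' hA'' => ?_) _
    · rw [Finset.card_insert_of_notMem hAT]
      exact Nat.lt_succ_self _
    · obtain h | h := Finset.mem_insert.1 hA''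
      · exact h ▸ hHX A B (mem_row.1 hB)
      · exact hHd.eval_eq_zero_of_card_right (Finset.mem_filter.1 h).2
          (fun B' hB' => hHX _ _ (mem_row.1 hB')) _
  have hA'B₀ : eval (Sum.elim A'.rep B₀.rep) H = 0 := by
    refine hHd.eval_eq_zero_of_card_right (Z := insert B (row X A')) ?_ (fun B' hB' => ?_) _
    · rw [Finset.card_insert_of_notMem hcon]
      exact Nat.lt_succ_self _
    · obtain h | h := Finset.mem_insert.1 hB'
      · exact h ▸ hA'B
      · exact hHX _ _ (mem_row.1 h)
  rw [← eval_eq_of_sub_mem_span_linY hsH, map_mul, map_pow, eval_linY, hm, one_pow, one_mul,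
    eval_prod_linX_eq_zero_iff] at hA'B₀
  exact hA'T hA'B₀

end Points

end BiProj

theorem mainTheorem1 {k : Type*} [Field k] [IsAlgClosed k] [CharZero k]
    (X : Set (BiProj.Point k)) (hfin : X.Finite) (hne : X.Nonempty) :
    BiProj.IsACM X ↔ ∀ P ∈ X, (BiProj.pointDegree X P).encard = 1 := by
  have hinf : Infinite k := IsAlgClosed.instInfinite
  lift X to Finset (BiProj.Point k) using hfin
  exact ⟨fun h P hP => h.hasNestedRows.encard_pointDegree hP,
    fun h => (BiProj.hasNestedRows_of_encard_pointDegree h).isACM hne⟩
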